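/- For $\alpha>-1$ let $L_k^\alpha(x)=\sum_{i=0}^{k}(-1)^i\binom{k+\alpha}{k-i}\frac{x^i}{i!}$ denote the Laguerre polynomials. A function $f\colon[0,\infty)\to\mathbb{R}$ is said to have the $\alpha$-SILP property if (1) $f$ is continuous and there are $\varepsilon>0$ and $C>0$ with $|f(x)|\le C(1+x)^{-\alpha-1-\varepsilon}$ for all $x\ge 0$, and (2) for every $y>0$ and every integer $j\ge 0$ the Laguerre coefficient $$a_j(y)=\frac{\int_0^\infty f(x/y)\,L_j^\alpha(x)\,x^\alpha e^{-x}\,dx}{\int_0^\infty L_j^\alpha(x)^2\,x^\alpha e^{-x}\,dx}$$ of $x\mapsto f(x/y)$ is non-negative. Let $n>1$ be an integer and let $f\colon[0,\infty)\to\mathbb{R}$ be a function. Then $f$ has the $(n/2-1)$-SILP property if and only if the function $\mathbb{R}^n\to\mathbb{R}$, $x\mapsto f(|x|^2)$, is continuous, satisfies $$|f(|x|^2)|\le C(1+|x|)^{-n-\varepsilon}\quad\text{for all }x\in\mathbb{R}^n$$ for some $C>0$ and $\varepsilon>0$, and is the Fourier transform of a non-negative tempered distribution. Here the Fourier transform is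 normalized by $\widehat\varphi(t)=\int_{\mathbb{R}^n}\varphi(x)e^{2\pi i\langle t,x\rangle}\,dx$ and extended to tempered distributions by $\widehat T(\varphi)=T(\widehat\varphi)$, and a distribution $T$ is non-negative if $T(\varphi)\ge 0$ for every non-negative compactly supported smooth function $\varphi$. -/

import Mathlib

open scoped NNReal SchwartzMap FourierTransform

noncomputable section

/-- The (generalized) Laguerre polynomial of degree `k` and parameter `α > -1`,
`L_k^α(x) = ∑_{i ≤ k} (-1)^i binom(k+α, k-i) x^i / i!`, the binomial coefficient being
`Γ(k+α+1) / (Γ(α+i+1) (k-i)!)`. -/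
def laguerre (α : ℝ) (k : ℕ) (x : ℝ) : ℝ :=
  ∑ i ∈ Finset.range (k + 1),
    (-1) ^ i * (Real.Gamma (k + α + 1) / (Real.Gamma (α + i + 1) * (k - i).factorial))
      * (x ^ i / i.factorial)

/-- The `j`-th coefficient of the Laguerre series `∑ a_j L_j^α` of a function `g` on `[0,∞)`,
with respect to the weight `x^α e^{-x}`. -/
def laguerreCoeff (α : ℝ) (g : ℝ≥0 → ℝ) (j : ℕ) : ℝ :=
  (∫ x in Set.Ioi (0 : ℝ), g x.toNNReal * laguerre α j x * x ^ α * Real.exp (-x)) /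
    (∫ x in Set.Ioi (0 : ℝ), laguerre α j x ^ 2 * x ^ α * Real.exp (-x))

/-- The `α`-SILP property (scale-invariant Laguerre positivity) of `f : [0,∞) → ℝ`. -/
structure IsSILP (α : ℝ) (f : ℝ≥0 → ℝ) : Prop where
  continuous : Continuous f
  decay : ∃ ε > (0 : ℝ), ∃ C > (0 : ℝ), ∀ x : ℝ≥0, |f x| ≤ C * (1 + (x : ℝ)) ^ (-α - 1 - ε)
  coeff_nonneg : ∀ y : ℝ≥0, 0 < y → ∀ j : ℕ, 0 ≤ laguerreCoeff α (fun x => f (x / y)) j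

open scoped ComplexOrder in
/-- A tempered distribution is non-negative if it takes non-negative (real) values on all
non-negative, compactly supported smooth test functions. In `ℂ`, `0 ≤ z` means that `z` is real
and non-negative. -/
def IsNonnegDistribution {n : ℕ} (T : 𝓢'(EuclideanSpace ℝ (Fin n), ℂ)) : Prop :=
  ∀ φ : 𝓢(EuclideanSpace ℝ (Fin n), ℂ), HasCompactSupport φ → (∀ x, 0 ≤ φ x) → 0 ≤ T φ

/-- The tempered distribution `T` is given by integration against the function `F`. -/
def IsGivenBy {n : ℕ} (T : 𝓢'(EuclideanSpace ℝ (Fin n), ℂ))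
    (F : EuclideanSpace ℝ (Fin n) → ℝ) : Prop :=
  ∀ φ : 𝓢(EuclideanSpace ℝ (Fin n), ℂ),
    MeasureTheory.Integrable (fun x => φ x * (F x : ℂ)) ∧ T φ = ∫ x, φ x * (F x : ℂ)

/-- `F` is the Fourier transform of a non-negative (tempered) distribution. The Fourier transform
is normalized by `t ↦ ∫ φ x * exp (2πi⟪t, x⟫)`, with a plus sign in the exponent; this is what
Mathlib denotes by `𝓕⁻`, extended to tempered distributions by duality. -/
def IsFourierTransformOfNonneg {n : ℕ} (F : EuclideanSpace ℝ (Fin n) → ℝ) : Prop :=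
  ∃ T : 𝓢'(EuclideanSpace ℝ (Fin n), ℂ), IsNonnegDistribution T ∧ IsGivenBy (𝓕⁻ T) F

end

/-! Put `F x = f (‖x‖ ^ 2)`. The exponent `n / 2 - 1` is the one for which the Laguerre weight comes
from Lebesgue measure on `ℝ^n` in the variable `s = ‖x‖ ^ 2`. The Fourier transform of `‖x‖ ^ (2j)
exp (-b ‖x‖ ^ 2)` is a positive multiple of `L_j (π² ‖w‖² / b) exp (-π² ‖w‖² / b)`
(`fourier_normPow_mul_gaussian`). With `b = π² / y`, moving the Fourier transform across the pairing
shows that the `j`-th coefficient at scale `y` has the sign of the integral of `𝓕 F` against `‖w‖ ^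
(2j) exp (-b ‖w‖ ^ 2)` (`laguerreCoeff_nonneg_iff`).

Hence `𝓕 F ≥ 0` makes all coefficients non-negative. Conversely, as `j` and `b` grow proportionally,
these weights concentrate on any prescribed sphere, so non-negative moments force the continuous
function `𝓕 F` to be non-negative (`nonneg_of_gaussian_moments_nonneg`).

The decay makes `F` integrable, so a distribution transforming to `F` can only be `𝓕 F`, and its
non-negativity is pointwise (`isFourierTransformOfNonneg_iff`). The sign in the Fourier exponent is
harmless because `F` is even. -/

/-! ### Radial integrals and Gaussian moments -/

open MeasureTheory Real Set Filter Topology in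
/-- Integration of a function of `‖x‖ ^ 2` over Euclidean space. -/
theorem integral_fun_norm_sq (n : ℕ) (hn : 0 < n) (g : ℝ → ℝ) :
    ∫ x : EuclideanSpace ℝ (Fin n), g (‖x‖ ^ 2) =
      (n * volume.real (Metric.ball (0 : EuclideanSpace ℝ (Fin n)) 1) / 2) *
        ∫ s in Ioi (0 : ℝ), s ^ ((n : ℝ) / 2 - 1) * g s := by
  have : Nonempty (Fin n) := ⟨⟨0, hn⟩⟩
  rw [integral_fun_norm_addHaar volume (fun r => g (r ^ 2)), ← integral_comp_rpow_Ioi_of_pos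
    (g := fun s => s ^ ((n : ℝ) / 2 - 1) * g s) (p := 2) two_pos]
  have : ∫ x in Ioi (0 : ℝ), (2 * x ^ ((2 : ℝ) - 1)) • ((x ^ (2 : ℝ)) ^ ((n : ℝ) / 2 - 1) *
      g (x ^ (2 : ℝ))) = 2 * ∫ y in Ioi (0 : ℝ), y ^ (n - 1) * g (y ^ 2) := by
    rw [← integral_const_mul]
    refine setIntegral_congr_fun measurableSet_Ioi fun x hx => ?_
    have hx : 0 < x := hx
    have h1 : x ^ (n - 1) = x * (x ^ (2 : ℝ)) ^ ((n : ℝ) / 2 - 1) := by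
      rw [← rpow_mul hx.le, ← rpow_natCast, Nat.cast_pred hn]
      nth_rewrite 2 [← rpow_one x]
      rw [← rpow_add hx]
      congr 1; ring
    have h2 : (2 : ℝ) - 1 = 1 := by norm_num
    simp only [smul_eq_mul, h1, h2, rpow_one, ← rpow_two]
    ring
  rw [this]
  simp only [finrank_euclideanSpace, Fintype.card_fin, nsmul_eq_mul, smul_eq_mul]
  ring

open MeasureTheory Real Set in
theorem ballConst_pos (n : ℕ) (hn : 0 < n) :
    0 < n * volume.real (Metric.ball (0 : EuclideanSpace ℝ (Fin n)) 1) / 2 := by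
  have : 0 < volume.real (Metric.ball (0 : EuclideanSpace ℝ (Fin n)) 1) :=
    ENNReal.toReal_pos (Metric.measure_ball_pos _ _ one_pos).ne' measure_ball_lt_top.ne
  positivity

open MeasureTheory Real Set in
theorem integrable_normPow_mul_gaussian (n : ℕ) (hn : 0 < n) {b : ℝ} (hb : 0 < b) (j : ℕ) :
    Integrable fun x : EuclideanSpace ℝ (Fin n) => (‖x‖ ^ 2) ^ j * exp (-b * ‖x‖ ^ 2) := by
  have : Nonempty (Fin n) := ⟨⟨0, hn⟩⟩
  refine (integrable_fun_norm_addHaar volume (f := fun r => (r ^ 2) ^ j * exp (-b * r ^ 2))).2 ?_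
  have := integrableOn_rpow_mul_exp_neg_mul_sq hb (s := ((n - 1 + 2 * j : ℕ) : ℝ))
    (by linarith [Nat.cast_nonneg (α := ℝ) (n - 1 + 2 * j)])
  refine this.congr_fun (fun x _ => ?_) measurableSet_Ioi
  simp only [finrank_euclideanSpace, Fintype.card_fin, smul_eq_mul, rpow_natCast]
  ring

open MeasureTheory Real Set in
theorem integral_normPow_mul_gaussian (n : ℕ) (hn : 0 < n) {b : ℝ} (hb : 0 < b) (j : ℕ) :
    ∫ x : EuclideanSpace ℝ (Fin n), (‖x‖ ^ 2) ^ j * exp (-b * ‖x‖ ^ 2) =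
      (n * volume.real (Metric.ball (0 : EuclideanSpace ℝ (Fin n)) 1) / 2) *
        ((1 / b) ^ (j + (n : ℝ) / 2) * Gamma (j + (n : ℝ) / 2)) := by
  have hn' : (0 : ℝ) < n := by exact_mod_cast hn
  rw [integral_fun_norm_sq n hn (fun s => s ^ j * exp (-b * s)),
    ← integral_rpow_mul_exp_neg_mul_Ioi (by positivity) hb]
  congr 1
  refine setIntegral_congr_fun measurableSet_Ioi fun s hs => ?_
  have hs : 0 < s := hs
  rw [← rpow_natCast s j, ← mul_assoc, ← rpow_add hs]
  ring_nf

/-- The substitution `x = y s` in a Laguerre coefficient. -/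
theorem integral_laguerre_eq (n : ℕ) (hn : 0 < n) (f : ℝ≥0 → ℝ) {y : ℝ≥0} (hy : 0 < y) (j : ℕ) :
    (n * MeasureTheory.volume.real (Metric.ball (0 : EuclideanSpace ℝ (Fin n)) 1) / 2) *
      (∫ x in Set.Ioi (0 : ℝ), f (x.toNNReal / y) * laguerre ((n : ℝ) / 2 - 1) j x *
        x ^ ((n : ℝ) / 2 - 1) * Real.exp (-x)) =
    (y : ℝ) ^ ((n : ℝ) / 2) * ∫ x : EuclideanSpace ℝ (Fin n), f (‖x‖₊ ^ 2) *
      (laguerre ((n : ℝ) / 2 - 1) j (y * ‖x‖ ^ 2) * Real.exp (-(y * ‖x‖ ^ 2))) := by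
  have hy' : (0 : ℝ) < y := hy
  have h := integral_fun_norm_sq n hn (fun s => f s.toNNReal *
    (laguerre ((n : ℝ) / 2 - 1) j (y * s) * Real.exp (-(y * s))))
  have h0 : ∀ x : EuclideanSpace ℝ (Fin n), (‖x‖ ^ 2).toNNReal = ‖x‖₊ ^ 2 := fun x => by
    rw [Real.toNNReal_pow (norm_nonneg x), norm_toNNReal]
  simp only [h0] at h
  rw [h, mul_left_comm]
  congr 1
  have h2 := MeasureTheory.integral_comp_mul_left_Ioi (fun x => f (x.toNNReal / y) *
    laguerre ((n : ℝ) / 2 - 1) j x * x ^ ((n : ℝ) / 2 - 1) * Real.exp (-x)) 0 hy'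
  rw [mul_zero, smul_eq_mul, eq_inv_mul_iff_mul_eq₀ hy'.ne'] at h2
  rw [← h2, ← MeasureTheory.integral_const_mul, ← MeasureTheory.integral_const_mul]
  refine MeasureTheory.setIntegral_congr_fun measurableSet_Ioi fun s hs => ?_
  have hs : 0 < s := hs
  have h3 : (y * s : ℝ).toNNReal / y = s.toNNReal := by
    rw [Real.toNNReal_mul hy'.le, Real.toNNReal_coe, mul_comm, mul_div_assoc,
      div_self hy.ne', mul_one]
  have h4 : (y : ℝ) ^ ((n : ℝ) / 2) = y * (y : ℝ) ^ ((n : ℝ) / 2 - 1) := by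
    rw [← Real.rpow_one_add' hy'.le (by ring_nf; positivity)]; congr 1; ring
  simp only [h3, Real.mul_rpow hy'.le hs.le, h4]
  ring

/-! ### Laguerre polynomials and their raising relation -/

theorem continuous_laguerre (α : ℝ) (k : ℕ) : Continuous (laguerre α k) := by
  unfold laguerre
  fun_prop

theorem laguerre_zero_left {α : ℝ} (hα : -1 < α) (x : ℝ) : laguerre α 0 x = 1 := by
  have : Real.Gamma (α + 1) ≠ 0 := (Real.Gamma_pos_of_pos (by linarith)).ne'
  simp [laguerre, this]

theorem laguerre_zero_right_pos {α : ℝ} (hα : -1 < α) (k : ℕ) : 0 < laguerre α k 0 := by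
  have h1 : 0 < Real.Gamma (α + 1) := Real.Gamma_pos_of_pos (by linarith)
  have h2 : 0 < Real.Gamma (k + α + 1) :=
    Real.Gamma_pos_of_pos (by linarith [Nat.cast_nonneg (α := ℝ) k])
  unfold laguerre
  rw [Finset.sum_range_succ', Finset.sum_eq_zero (by intros; simp)]
  simp
  positivity

/-- The first-order relation `x L_k' = (k + 1) L_{k+1} - (k + α + 1 - x) L_k`. -/
theorem hasDerivAt_laguerre {α : ℝ} (hα : -1 < α) (k : ℕ) (x : ℝ) :
    ∃ D, HasDerivAt (laguerre α k) D x ∧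
      x * D = (k + 1) * laguerre α (k + 1) x - (k + α + 1 - x) * laguerre α k x := by
  have hG : ∀ i : ℕ, 0 < Real.Gamma (α + i + 1) := fun i =>
    Real.Gamma_pos_of_pos (by linarith [Nat.cast_nonneg (α := ℝ) i])
  have hGs : ∀ i : ℕ, Real.Gamma (α + (i + 1 : ℕ) + 1) = (α + i + 1) * Real.Gamma (α + i + 1) :=
    fun i => by
      rw [← Real.Gamma_add_one (by linarith [Nat.cast_nonneg (α := ℝ) i])]
      push_cast
      congr 1
      ring
  have hGk : ∀ i : ℕ, Real.Gamma (i + α + 1) = Real.Gamma (α + i + 1) := fun i => by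
    rw [add_comm (i : ℝ)]
  refine ⟨∑ i ∈ Finset.range (k + 1),
    (-1) ^ i * (Real.Gamma (k + α + 1) / (Real.Gamma (α + i + 1) * (k - i).factorial))
      * ((i * x ^ (i - 1)) / i.factorial), ?_, ?_⟩
  · unfold laguerre
    refine HasDerivAt.fun_sum fun i _ => ?_
    exact ((hasDerivAt_pow i x).div_const _).const_mul _
  · have hd : x * ∑ i ∈ Finset.range (k + 1),
        (-1) ^ i * (Real.Gamma (k + α + 1) / (Real.Gamma (α + i + 1) * (k - i).factorial))
        * ((i * x ^ (i - 1)) / i.factorial) = ∑ i ∈ Finset.range (k + 1),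
        i * ((-1) ^ i * (Real.Gamma (k + α + 1) / (Real.Gamma (α + i + 1) * (k - i).factorial))
        * (x ^ i / i.factorial)) := by
      rw [Finset.mul_sum]
      refine Finset.sum_congr rfl fun i _ => ?_
      rcases i with _ | i
      · simp
      · simp only [Nat.add_sub_cancel, pow_succ]; ring
    rw [hd]
    suffices h : (k + 1) * laguerre α (k + 1) x = ∑ i ∈ Finset.range (k + 1), (k + α + 1 + i) *
        ((-1) ^ i * (Real.Gamma (k + α + 1) / (Real.Gamma (α + i + 1) * (k - i).factorial))
        * (x ^ i / i.factorial)) - x * laguerre α k x by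
      rw [h]
      simp only [add_mul (k + α + 1 : ℝ), Finset.sum_add_distrib, ← Finset.mul_sum]
      unfold laguerre
      ring
    unfold laguerre
    -- Compare coefficients: powers `1, …, k` match termwise (`hmid`); the constant term and `x ^ (k
    -- + 1)` are split off and checked separately.
    rw [Finset.sum_range_succ' _ (k + 1), Finset.sum_range_succ _ k,
      Finset.sum_range_succ' _ k, Finset.sum_range_succ _ k, mul_add, mul_add, mul_add,
      Finset.mul_sum, Finset.mul_sum]
    have hmid : ∑ i ∈ Finset.range k, (k + 1 : ℝ) * ((-1) ^ (i + 1) *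
          (Real.Gamma ((k + 1 : ℕ) + α + 1) / (Real.Gamma (α + (i + 1 : ℕ) + 1) *
            (k + 1 - (i + 1)).factorial)) * (x ^ (i + 1) / (i + 1).factorial)) =
        ∑ i ∈ Finset.range k, (k + α + 1 + (i + 1 : ℕ)) * ((-1) ^ (i + 1) *
          (Real.Gamma (k + α + 1) / (Real.Gamma (α + (i + 1 : ℕ) + 1) * (k - (i + 1)).factorial))
          * (x ^ (i + 1) / (i + 1).factorial)) -
        ∑ i ∈ Finset.range k, x * ((-1) ^ i *
          (Real.Gamma (k + α + 1) / (Real.Gamma (α + i + 1) * (k - i).factorial))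
          * (x ^ i / i.factorial)) := by
      rw [← Finset.sum_sub_distrib]
      refine Finset.sum_congr rfl fun i hi => ?_
      obtain ⟨m, rfl⟩ := Nat.exists_eq_add_of_lt (Finset.mem_range.1 hi)
      have e1 : i + m + 1 + 1 - (i + 1) = m + 1 := by omega
      have e2 : i + m + 1 - (i + 1) = m := by omega
      have e3 : i + m + 1 - i = m + 1 := by omega
      have hi1 : α + i + 1 ≠ 0 := by linarith [Nat.cast_nonneg (α := ℝ) i]
      have := (hG i).ne'
      rw [e1, e2, e3, hGk, hGk, hGs (i + m + 1), hGs i, Nat.factorial_succ, Nat.factorial_succ]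
      push_cast
      field_simp
      ring
    rw [hmid]
    have key : ∀ A B T Z T₂ Z₂ : ℝ, T + Z = Z₂ - T₂ → A - B + T + Z = A + Z₂ - (B + T₂) := by
      intros; linarith
    refine key _ _ _ _ _ _ ?_
    have h0 := (hG 0).ne'
    have hk := (hG k).ne'
    have hk' : α + k + 1 ≠ 0 := by linarith [Nat.cast_nonneg (α := ℝ) k]
    simp only [hGk, hGs, Nat.sub_self, Nat.sub_zero, Nat.factorial_succ, Nat.factorial_zero,
      Nat.cast_zero, Nat.cast_one, pow_zero, pow_succ]
    push_cast
    field_simp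
    ring

/-- The power of `b` is chosen so that its derivative, together with that of the exponential,
cancels the `L_k` term of the first-order relation, leaving only `L_{k+1}`. This is the induction
step for the Fourier transform formula. -/
theorem hasDerivAt_rpow_mul_laguerre {α : ℝ} (hα : -1 < α) (k : ℕ) (s : ℝ) {b : ℝ} (hb : 0 < b) :
    HasDerivAt (fun b => b ^ (-(α + 1) - k) * (laguerre α k (s / b) * Real.exp (-(s / b))))
      (-(k + 1) * (b ^ (-(α + 1) - (k + 1 : ℕ)) *
        (laguerre α (k + 1) (s / b) * Real.exp (-(s / b))))) b := by
  obtain ⟨D, hD, hD'⟩ := hasDerivAt_laguerre hα k (s / b)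
  have h1 : HasDerivAt (fun b : ℝ => s / b) (-(s / b) / b) b := by
    refine ((hasDerivAt_const b s).div (hasDerivAt_id b) hb.ne').congr_deriv ?_
    simp only [id]
    field_simp
    ring
  have h2 := hD.comp b h1
  have h3 : HasDerivAt (fun b => Real.exp (-(s / b))) _ b := h1.fun_neg.exp
  have h4 := Real.hasDerivAt_rpow_const (x := b) (p := -(α + 1) - k) (Or.inl hb.ne')
  have h5 : b ^ (-(α + 1) - k) = b * b ^ (-(α + 1) - (k + 1 : ℕ)) := by
    rw [← Real.rpow_one_add' hb.le] <;> push_cast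
    · congr 1; ring
    · linarith [Nat.cast_nonneg (α := ℝ) k]
  have h6 : (-(α + 1) - k - 1 : ℝ) = -(α + 1) - (k + 1 : ℕ) := by push_cast; ring
  refine (h4.mul (h2.mul h3)).congr_deriv ?_
  simp only [Function.comp, Pi.mul_apply]
  rw [h6, h5]
  have h7 : D * (-(s / b) / b) = -((k + 1) * laguerre α (k + 1) (s / b) -
      (k + α + 1 - s / b) * laguerre α k (s / b)) / b := by
    rw [← hD']; ring
  rw [h7]
  field_simp
  ring

/-! ### Fourier transforms of powers times Gaussians -/

open MeasureTheory Real Filter Topology in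
theorem hasDerivAt_fourier_normPow_mul_gaussian (n : ℕ) (hn : 0 < n) (j : ℕ)
    (w : EuclideanSpace ℝ (Fin n)) {b : ℝ} (hb : 0 < b) :
    HasDerivAt (fun b : ℝ => 𝓕 (fun x : EuclideanSpace ℝ (Fin n) =>
        (((‖x‖ ^ 2) ^ j * exp (-b * ‖x‖ ^ 2) : ℝ) : ℂ)) w)
      (-𝓕 (fun x : EuclideanSpace ℝ (Fin n) =>
        (((‖x‖ ^ 2) ^ (j + 1) * exp (-b * ‖x‖ ^ 2) : ℝ) : ℂ)) w) b := by
  simp only [Real.fourier_eq', ← integral_neg]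
  have hnorm : ∀ (x : EuclideanSpace ℝ (Fin n)) (r : ℝ),
      ‖Complex.exp (↑(-2 * π * inner ℝ x w) * Complex.I) • (r : ℂ)‖ = |r| := fun x r => by
    rw [norm_smul, Complex.norm_exp_ofReal_mul_I, one_mul, Complex.norm_real, norm_eq_abs]
  -- For parameters above `b / 2`, the Gaussian of parameter `b / 2` gives a uniform integrable
  -- bound.
  refine (hasDerivAt_integral_of_dominated_loc_of_deriv_le (𝕜 := ℝ) (Ioi_mem_nhds (half_lt_self hb))
    (F' := fun b x => -(Complex.exp (↑(-2 * π * inner ℝ x w) * Complex.I) •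
      (((‖x‖ ^ 2) ^ (j + 1) * exp (-b * ‖x‖ ^ 2) : ℝ) : ℂ)))
    (bound := fun x => (‖x‖ ^ 2) ^ (j + 1) * exp (-(b / 2) * ‖x‖ ^ 2)) ?_ ?_ ?_ ?_
    (integrable_normPow_mul_gaussian n hn (half_pos hb) _) ?_).2
  · exact Eventually.of_forall fun b => Continuous.aestronglyMeasurable (by fun_prop)
  · refine (integrable_normPow_mul_gaussian n hn hb j).norm.mono'
      (Continuous.aestronglyMeasurable (by fun_prop)) (Eventually.of_forall fun x => ?_)
    rw [hnorm, norm_eq_abs]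
  · exact Continuous.aestronglyMeasurable (by fun_prop)
  · refine Eventually.of_forall fun x c hc => ?_
    have hc : b / 2 < c := hc
    rw [norm_neg, hnorm, abs_of_nonneg (by positivity)]
    gcongr
  · refine Eventually.of_forall fun x c _ => ?_
    have h : HasDerivAt (fun c : ℝ => (‖x‖ ^ 2) ^ j * exp (-c * ‖x‖ ^ 2))
        (-((‖x‖ ^ 2) ^ (j + 1) * exp (-c * ‖x‖ ^ 2))) c := by
      refine (((hasDerivAt_id c).neg.mul_const (‖x‖ ^ 2)).exp.const_mul
        ((‖x‖ ^ 2) ^ j)).congr_deriv ?_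
      simp; ring
    refine (h.ofReal_comp.const_smul
      (Complex.exp (↑(-2 * π * inner ℝ x w) * Complex.I))).congr_deriv ?_
    simp

open MeasureTheory Real Filter Topology in
/-- The Fourier transform of `‖x‖ ^ (2j) exp (-b ‖x‖ ^ 2)` is a positive multiple of a Laguerre
polynomial in `‖w‖ ^ 2` times a Gaussian. -/
theorem fourier_normPow_mul_gaussian (n : ℕ) (hn : 0 < n) (j : ℕ)
    (w : EuclideanSpace ℝ (Fin n)) {b : ℝ} (hb : 0 < b) :
    𝓕 (fun x : EuclideanSpace ℝ (Fin n) =>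
        (((‖x‖ ^ 2) ^ j * exp (-b * ‖x‖ ^ 2) : ℝ) : ℂ)) w =
      ((π ^ ((n : ℝ) / 2) * j.factorial * (b ^ (-((n : ℝ) / 2 - 1 + 1) - j) *
        (laguerre ((n : ℝ) / 2 - 1) j (π ^ 2 * ‖w‖ ^ 2 / b) *
          exp (-(π ^ 2 * ‖w‖ ^ 2 / b)))) : ℝ) : ℂ) := by
  have hα : -1 < (n : ℝ) / 2 - 1 := by
    have : (0 : ℝ) < n := by exact_mod_cast hn
    linarith [half_pos this]
  induction j generalizing b with
  | zero =>
    have h := fourier_gaussian_innerProductSpace (V := EuclideanSpace ℝ (Fin n)) (b := b)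
      (by simpa using hb) w
    have h1 : (fun x : EuclideanSpace ℝ (Fin n) => (((‖x‖ ^ 2) ^ 0 * exp (-b * ‖x‖ ^ 2) : ℝ) : ℂ))
        = fun x => Complex.exp (-b * ‖x‖ ^ 2) := by
      ext x; push_cast; simp
    rw [h1, h, laguerre_zero_left hα]
    have h2 : ((π : ℂ) / b) ^ ((Module.finrank ℝ (EuclideanSpace ℝ (Fin n)) : ℂ) / 2) =
        (((π / b) ^ ((n : ℝ) / 2) : ℝ) : ℂ) := by
      rw [Complex.ofReal_cpow (by positivity)]
      simp
    rw [h2, div_rpow pi_pos.le hb.le]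
    have h3 : -((n : ℝ) / 2 - 1 + 1) - (0 : ℕ) = -((n : ℝ) / 2) := by simp
    rw [h3, rpow_neg hb.le]
    push_cast
    simp [div_eq_mul_inv, mul_assoc]
  | succ j ih =>
    -- Differentiating the case `j` in `b` raises `j` on both sides; the factor `j + 1` completes
    -- the factorial.
    have h1 := hasDerivAt_fourier_normPow_mul_gaussian n hn j w hb
    have h2 := (((hasDerivAt_rpow_mul_laguerre hα j (π ^ 2 * ‖w‖ ^ 2) hb).const_mul
      (π ^ ((n : ℝ) / 2) * j.factorial)).ofReal_comp)
    have h3 := h1.unique (h2.congr_of_eventuallyEq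
      ((eventually_gt_nhds hb).mono fun c hc => ih hc))
    rw [neg_eq_iff_eq_neg] at h3
    rw [h3, Nat.factorial_succ]
    push_cast
    ring

/-! ### Positivity of the normalizing integral -/

open MeasureTheory Set in
theorem integrableOn_laguerre_sq {α : ℝ} (hα : -1 < α) (k : ℕ) :
    IntegrableOn (fun x => laguerre α k x ^ 2 * x ^ α * Real.exp (-x)) (Ioi 0) := by
  unfold laguerre
  simp only [sq, Finset.sum_mul, Finset.mul_sum]
  refine integrable_finsetSum _ fun i _ => integrable_finsetSum _ fun l _ => ?_
  have h := (Real.GammaIntegral_convergent (s := (i + l : ℕ) + α + 1)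
    (by linarith [Nat.cast_nonneg (α := ℝ) (i + l)])).const_mul
    (((-1) ^ i * (Real.Gamma (k + α + 1) / (Real.Gamma (α + i + 1) * (k - i).factorial))
      * (1 / i.factorial)) *
    ((-1) ^ l * (Real.Gamma (k + α + 1) / (Real.Gamma (α + l + 1) * (k - l).factorial))
      * (1 / l.factorial)))
  refine IntegrableOn.congr_fun h (fun x hx => ?_) measurableSet_Ioi
  have hx : 0 < x := hx
  simp only [add_sub_cancel_right, Real.rpow_add hx, Real.rpow_natCast, pow_add]
  ring

-- Since `L_k` is positive at `0`, the integrand is positive on an interval `(0, ε)`. Thus the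
-- denominator of a Laguerre coefficient does not affect its sign.
open MeasureTheory Set Filter Topology in
theorem integral_laguerre_sq_pos {α : ℝ} (hα : -1 < α) (k : ℕ) :
    0 < ∫ x in Ioi (0 : ℝ), laguerre α k x ^ 2 * x ^ α * Real.exp (-x) := by
  rw [setIntegral_pos_iff_support_of_nonneg_ae _ (integrableOn_laguerre_sq hα k)]
  · have h : ∀ᶠ x in 𝓝 (0 : ℝ), 0 < laguerre α k x :=
      continuousAt_const.eventually_lt (continuous_laguerre α k).continuousAt
        (laguerre_zero_right_pos hα k)
    obtain ⟨ε, hε, h⟩ := Metric.eventually_nhds_iff.1 h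
    have hsub : Ioo 0 ε ⊆ (Function.support fun x => laguerre α k x ^ 2 * x ^ α * Real.exp (-x)) ∩
        Ioi 0 := fun x hx => by
      have hx0 : 0 < x := hx.1
      have : 0 < laguerre α k x := h (by simpa [abs_of_pos hx.1] using hx.2)
      refine ⟨ne_of_gt ?_, hx0⟩
      positivity
    refine lt_of_lt_of_le ?_ (measure_mono hsub)
    simpa using hε
  · filter_upwards [ae_restrict_mem measurableSet_Ioi] with x hx
    have hx : 0 < x := hx
    have : 0 < x ^ α := Real.rpow_pos_of_pos hx α
    simp only [Pi.zero_apply]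
    positivity

/-! ### Fourier transforms of radial functions -/

section RadialFourier

variable {n : ℕ}

theorem fourier_eq_of_norm_eq {F : EuclideanSpace ℝ (Fin n) → ℂ}
    (hF : ∀ x y, ‖x‖ = ‖y‖ → F x = F y) {v w : EuclideanSpace ℝ (Fin n)} (h : ‖v‖ = ‖w‖) :
    𝓕 F v = 𝓕 F w := by
  -- Vectors of equal norm are exchanged by the reflection in the hyperplane orthogonal to their
  -- difference.
  let A := (ℝ ∙ (v - w))ᗮ.reflection
  have h1 : F ∘ A = F := by
    ext x
    exact hF _ _ (A.norm_map x)
  calc 𝓕 F v = 𝓕 (F ∘ A) v := by rw [h1]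
    _ = 𝓕 F (A v) := Real.fourier_comp_linearIsometry A F v
    _ = 𝓕 F w := by rw [Submodule.reflection_sub h]

/-- For real `F`, conjugating the transform replaces `w` by `-w`, which radial symmetry undoes. -/
theorem ofReal_re_fourier {F : EuclideanSpace ℝ (Fin n) → ℝ}
    (hF : ∀ x y, ‖x‖ = ‖y‖ → F x = F y) (w : EuclideanSpace ℝ (Fin n)) :
    ((𝓕 (fun x => (F x : ℂ)) w).re : ℂ) = 𝓕 (fun x => (F x : ℂ)) w := by
  rw [← Complex.conj_eq_iff_re]
  calc (starRingEnd ℂ) (𝓕 (fun x => (F x : ℂ)) w) = 𝓕 (fun x => (F x : ℂ)) (-w) := by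
        rw [Real.fourier_eq', Real.fourier_eq', ← integral_conj]
        refine MeasureTheory.integral_congr_ae (Filter.Eventually.of_forall fun x => ?_)
        simp [← Complex.exp_conj, Complex.conj_ofNat]
    _ = _ := fourier_eq_of_norm_eq (fun x y h => by rw [hF x y h]) (norm_neg w)

theorem continuous_fourier_of_integrable {F : EuclideanSpace ℝ (Fin n) → ℂ}
    (hF : MeasureTheory.Integrable F) : Continuous (𝓕 F) :=
  VectorFourier.fourierIntegral_continuous Real.continuous_fourierChar
    (by exact continuous_inner) hF

theorem norm_fourier_le (F : EuclideanSpace ℝ (Fin n) → ℂ) (w : EuclideanSpace ℝ (Fin n)) :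
    ‖𝓕 F w‖ ≤ ∫ x, ‖F x‖ :=
  VectorFourier.norm_fourierIntegral_le_integral_norm _ _ _ _ _

theorem integral_fourier_mul {F H : EuclideanSpace ℝ (Fin n) → ℂ}
    (hF : MeasureTheory.Integrable F) (hH : MeasureTheory.Integrable H) :
    ∫ x, 𝓕 F x * H x = ∫ x, F x * 𝓕 H x := by
  have := VectorFourier.integral_fourierIntegral_smul_eq_flip (L := innerₗ _)
    Real.continuous_fourierChar (by exact continuous_inner) hF hH
  rw [flip_innerₗ] at this
  exact this

end RadialFourier

/-! ### Laguerre coefficients as Gaussian moments -/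

/-- The Laguerre coefficients of `x ↦ f (x / y)` have the sign of the moments of the Fourier
transform of `x ↦ f (‖x‖ ^ 2)` against a Gaussian. -/
theorem laguerreCoeff_nonneg_iff (n : ℕ) (hn : 0 < n) (f : ℝ≥0 → ℝ)
    (hF : MeasureTheory.Integrable fun x : EuclideanSpace ℝ (Fin n) => f (‖x‖₊ ^ 2))
    {y : ℝ≥0} (hy : 0 < y) (j : ℕ) :
    0 ≤ laguerreCoeff ((n : ℝ) / 2 - 1) (fun x => f (x / y)) j ↔
      0 ≤ ∫ w : EuclideanSpace ℝ (Fin n),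
        (𝓕 (fun x : EuclideanSpace ℝ (Fin n) => (f (‖x‖₊ ^ 2) : ℂ)) w).re *
          ((‖w‖ ^ 2) ^ j * Real.exp (-(Real.pi ^ 2 / y) * ‖w‖ ^ 2)) := by
  have hn' : (0 : ℝ) < n := by exact_mod_cast hn
  have hy' : (0 : ℝ) < y := hy
  have hα : -1 < (n : ℝ) / 2 - 1 := by linarith [half_pos hn']
  have hb : 0 < Real.pi ^ 2 / (y : ℝ) := by positivity
  have hrad : ∀ x z : EuclideanSpace ℝ (Fin n), ‖x‖ = ‖z‖ → f (‖x‖₊ ^ 2) = f (‖z‖₊ ^ 2) := by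
    intro x z h
    rw [show ‖x‖₊ = ‖z‖₊ from NNReal.eq h]
  have hden := integral_laguerre_sq_pos hα j
  unfold laguerreCoeff
  rw [le_div_iff₀ hden, zero_mul, ← mul_nonneg_iff_of_pos_left (ballConst_pos n hn),
    integral_laguerre_eq n hn f hy j, mul_nonneg_iff_of_pos_left (by positivity)]
  set A : ℝ := ∫ x : EuclideanSpace ℝ (Fin n), f (‖x‖₊ ^ 2) *
      (laguerre ((n : ℝ) / 2 - 1) j (y * ‖x‖ ^ 2) * Real.exp (-(y * ‖x‖ ^ 2))) with hA
  have hP := integral_fourier_mul hF.ofReal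
    (integrable_normPow_mul_gaussian n hn hb j).ofReal
  set c : ℝ := Real.pi ^ ((n : ℝ) / 2) * j.factorial *
    (Real.pi ^ 2 / (y : ℝ)) ^ (-((n : ℝ) / 2 - 1 + 1) - j) with hc
  have hcpos : 0 < c := by positivity
  have hR : ∫ x : EuclideanSpace ℝ (Fin n), (f (‖x‖₊ ^ 2) : ℂ) *
      𝓕 (fun x : EuclideanSpace ℝ (Fin n) =>
        (((‖x‖ ^ 2) ^ j * Real.exp (-(Real.pi ^ 2 / y) * ‖x‖ ^ 2) : ℝ) : ℂ)) x =
      ((c * A : ℝ) : ℂ) := by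
    rw [hA, ← MeasureTheory.integral_const_mul, ← integral_complex_ofReal]
    refine MeasureTheory.integral_congr_ae (Filter.Eventually.of_forall fun x => ?_)
    have hx : Real.pi ^ 2 * ‖x‖ ^ 2 / (Real.pi ^ 2 / (y : ℝ)) = y * ‖x‖ ^ 2 := by
      have := Real.pi_pos.ne'
      field_simp
    simp only [fourier_normPow_mul_gaussian n hn j x hb, hx, hc]
    push_cast
    ring
  have hL : ∫ w : EuclideanSpace ℝ (Fin n),
      𝓕 (fun x : EuclideanSpace ℝ (Fin n) => (f (‖x‖₊ ^ 2) : ℂ)) w *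
        (((‖w‖ ^ 2) ^ j * Real.exp (-(Real.pi ^ 2 / y) * ‖w‖ ^ 2) : ℝ) : ℂ) =
      ((∫ w : EuclideanSpace ℝ (Fin n),
        (𝓕 (fun x : EuclideanSpace ℝ (Fin n) => (f (‖x‖₊ ^ 2) : ℂ)) w).re *
          ((‖w‖ ^ 2) ^ j * Real.exp (-(Real.pi ^ 2 / y) * ‖w‖ ^ 2)) : ℝ) : ℂ) := by
    rw [← integral_complex_ofReal]
    refine MeasureTheory.integral_congr_ae (Filter.Eventually.of_forall fun w => ?_)
    simp only [Complex.ofReal_mul, ofReal_re_fourier hrad w]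
  have hE := hL.symm.trans (hP.trans hR)
  rw [Complex.ofReal_inj.1 hE, mul_nonneg_iff_of_pos_left hcpos]

/-! ### Concentration on spheres -/

open MeasureTheory Filter Topology in
/-- A bounded continuous radial function all of whose moments against Gaussians are nonnegative is
nonnegative, since the weights `‖x‖ ^ (2j) exp (-b ‖x‖ ^ 2)` concentrate on spheres. -/
theorem nonneg_of_gaussian_moments_nonneg (n : ℕ) (hn : 0 < n) {G : EuclideanSpace ℝ (Fin n) → ℝ}
    (hG : Continuous G) {M : ℝ} (hM : ∀ x, |G x| ≤ M) (hrad : ∀ x y, ‖x‖ = ‖y‖ → G x = G y)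
    (h : ∀ b : ℝ, 0 < b → ∀ j : ℕ,
      0 ≤ ∫ x : EuclideanSpace ℝ (Fin n), G x * ((‖x‖ ^ 2) ^ j * Real.exp (-b * ‖x‖ ^ 2)))
    (x : EuclideanSpace ℝ (Fin n)) : 0 ≤ G x := by
  have : Nonempty (Fin n) := ⟨⟨0, hn⟩⟩
  have hn' : (0 : ℝ) < n := by exact_mod_cast hn
  -- The scale `b = a / s₀` below needs a sphere of positive radius; the origin follows by density.
  suffices hne : ∀ x : EuclideanSpace ℝ (Fin n), x ≠ 0 → 0 ≤ G x by
    have hcl : IsClosed {x | 0 ≤ G x} := isClosed_le continuous_const hG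
    have hd : Dense ({0}ᶜ : Set (EuclideanSpace ℝ (Fin n))) := dense_compl_singleton 0
    exact hcl.closure_subset_iff.2 (fun x hx => hne x hx) (hd x)
  clear x
  intro x₀ hx₀
  by_contra! hneg
  have hx₀' : 0 < ‖x₀‖ := norm_pos_iff.2 hx₀
  set s₀ := ‖x₀‖ ^ 2 with hs₀
  have hs₀pos : 0 < s₀ := by positivity
  set δ := -G x₀ / 2 with hδ
  have hδpos : 0 < δ := by rw [hδ]; linarith
  have hMnn : 0 ≤ M := (abs_nonneg _).trans (hM x₀)
  have hcont : Continuous fun s : ℝ => G ((√s / ‖x₀‖) • x₀) := by fun_prop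
  have hval : ∀ x : EuclideanSpace ℝ (Fin n), G ((√(‖x‖ ^ 2) / ‖x₀‖) • x₀) = G x := fun x => by
    refine hrad _ _ ?_
    rw [norm_smul, Real.sqrt_sq (norm_nonneg x), norm_div, norm_norm, norm_norm,
      div_mul_cancel₀ _ hx₀'.ne']
  have hev : ∀ᶠ s in 𝓝 s₀, G ((√s / ‖x₀‖) • x₀) < -δ := by
    refine hcont.continuousAt.eventually_lt continuousAt_const ?_
    rw [hs₀, hval, hδ]; linarith
  obtain ⟨η, hη, hev⟩ := Metric.eventually_nhds_iff.1 hev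
  -- This `K` makes the parabola `-δ + K (s - s₀)²` reach `M` at distance `η` from `s₀`, so it
  -- dominates `G` everywhere.
  set K := (M + δ) / η ^ 2 with hK
  have hKnn : 0 ≤ K := by positivity
  have hbound : ∀ x, G x ≤ -δ + K * (‖x‖ ^ 2 - s₀) ^ 2 := fun x => by
    by_cases hx : |‖x‖ ^ 2 - s₀| < η
    · have h1 := hev (y := ‖x‖ ^ 2) (by rwa [Real.dist_eq])
      rw [hval] at h1
      have : 0 ≤ K * (‖x‖ ^ 2 - s₀) ^ 2 := by positivity
      linarith
    · have h1 : η ^ 2 ≤ (‖x‖ ^ 2 - s₀) ^ 2 := by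
        rw [← sq_abs (‖x‖ ^ 2 - s₀)]
        have := not_lt.1 hx
        gcongr
      have h2 : M + δ ≤ K * (‖x‖ ^ 2 - s₀) ^ 2 := by
        calc M + δ = K * η ^ 2 := by rw [hK]; field_simp
          _ ≤ _ := by gcongr
      linarith [le_abs_self (G x), hM x]
  -- In the variable `s = ‖x‖ ^ 2` the normalized weight is a Gamma distribution of shape `a`.
  -- Taking `b = a / s₀` gives mean `s₀` and variance `s₀² / a`; this `j` makes `K` times the
  -- variance smaller than `δ`.
  obtain ⟨j, hj⟩ := exists_nat_gt (K * s₀ ^ 2 / δ)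
  set a : ℝ := j + n / 2 with ha
  have hapos : 0 < a := by positivity
  set b := a / s₀ with hb
  have hbpos : 0 < b := by positivity
  have hI := fun i => integrable_normPow_mul_gaussian n hn hbpos i
  set m : ℕ → ℝ := fun i => ∫ x : EuclideanSpace ℝ (Fin n),
    (‖x‖ ^ 2) ^ i * Real.exp (-b * ‖x‖ ^ 2) with hm
  have hrec : ∀ i, m (i + 1) = (i + n / 2) / b * m i := fun i => by
    simp only [hm, integral_normPow_mul_gaussian n hn hbpos]
    have e : (((i + 1 : ℕ) : ℝ) + n / 2) = (i + n / 2) + 1 := by push_cast; ring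
    rw [e, Real.Gamma_add_one (by positivity), Real.rpow_add_one (by positivity)]
    ring
  have hmj : 0 < m j := by
    simp only [hm, integral_normPow_mul_gaussian n hn hbpos]
    have := ballConst_pos n hn
    have := Real.Gamma_pos_of_pos (s := j + (n : ℝ) / 2) (by positivity)
    positivity
  have hm1 : m (j + 1) = s₀ * m j := by
    rw [hrec, ← ha, hb]; field_simp
  have hm2 : m (j + 2) = (a + 1) / a * s₀ ^ 2 * m j := by
    rw [hrec (j + 1), hm1, hb]; push_cast
    rw [show (j + 1 + n / 2 : ℝ) = a + 1 by rw [ha]; ring]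
    field_simp
  have hle : ∫ x : EuclideanSpace ℝ (Fin n), G x * ((‖x‖ ^ 2) ^ j * Real.exp (-b * ‖x‖ ^ 2)) ≤
      ∫ x : EuclideanSpace ℝ (Fin n),
        (-δ + K * s₀ ^ 2) * ((‖x‖ ^ 2) ^ j * Real.exp (-b * ‖x‖ ^ 2)) +
        (-(2 * K * s₀)) * ((‖x‖ ^ 2) ^ (j + 1) * Real.exp (-b * ‖x‖ ^ 2)) +
        K * ((‖x‖ ^ 2) ^ (j + 2) * Real.exp (-b * ‖x‖ ^ 2)) := by
    refine integral_mono ((hI j).bdd_mul hG.aestronglyMeasurable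
      (Eventually.of_forall fun x => hM x))
      ((((hI j).const_mul _).add ((hI (j + 1)).const_mul _)).add ((hI (j + 2)).const_mul _))
      fun x => ?_
    calc G x * ((‖x‖ ^ 2) ^ j * Real.exp (-b * ‖x‖ ^ 2))
        ≤ (-δ + K * (‖x‖ ^ 2 - s₀) ^ 2) * ((‖x‖ ^ 2) ^ j * Real.exp (-b * ‖x‖ ^ 2)) := by
          gcongr; exact hbound x
      _ = _ := by ring
  rw [integral_add (((hI j).const_mul _).fun_add ((hI (j + 1)).const_mul _)) ((hI (j + 2)).const_mul _),
    integral_add ((hI j).const_mul _) ((hI (j + 1)).const_mul _), integral_const_mul,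
    integral_const_mul, integral_const_mul] at hle
  have hfin : 0 ≤ (-δ + K * s₀ ^ 2) * m j + -(2 * K * s₀) * m (j + 1) + K * m (j + 2) :=
    (h b hbpos j).trans hle
  rw [hm1, hm2] at hfin
  -- Chebyshev's argument: the dominating parabola has weighted mean `K s₀² / a - δ`, which is
  -- negative.
  have e : (-δ + K * s₀ ^ 2) * m j + -(2 * K * s₀) * (s₀ * m j) +
      K * ((a + 1) / a * s₀ ^ 2 * m j) = (K * s₀ ^ 2 / a - δ) * m j := by
    field_simp
    ring
  rw [e, mul_nonneg_iff_of_pos_right hmj] at hfin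
  have h3 : K * s₀ ^ 2 / a < δ := by
    rw [div_lt_iff₀ hδpos] at hj
    rw [div_lt_iff₀ hapos, mul_comm δ]
    refine hj.trans_le ?_
    gcongr
    rw [ha]; linarith [half_pos hn']
  linarith

/-! ### Non-negative distributions and pointwise positivity -/

section Distribution

variable {n : ℕ}

open MeasureTheory Filter

theorem integrable_schwartz_mul {F : EuclideanSpace ℝ (Fin n) → ℂ} (hF : Integrable F)
    (φ : 𝓢(EuclideanSpace ℝ (Fin n), ℂ)) : Integrable fun x => φ x * F x := by
  obtain ⟨C, hC⟩ := φ.decay 0 0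
  refine hF.bdd_mul φ.continuous.aestronglyMeasurable (c := C) (Eventually.of_forall fun x => ?_)
  simpa using hC.2 x

theorem integral_fourier_schwartz_mul {F : EuclideanSpace ℝ (Fin n) → ℝ} (hF : Integrable F)
    (hrad : ∀ x y, ‖x‖ = ‖y‖ → F x = F y) (φ : 𝓢(EuclideanSpace ℝ (Fin n), ℂ)) :
    ∫ x, (𝓕 φ) x * (F x : ℂ) = ∫ x, φ x * ((𝓕 (fun x => (F x : ℂ)) x).re : ℂ) := by
  simp only [ofReal_re_fourier hrad]
  exact integral_fourier_mul φ.integrable hF.ofReal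

open scoped ComplexOrder in
/-- An integrable radial function is the Fourier transform of a nonnegative distribution if and
only if its Fourier transform is pointwise nonnegative. -/
theorem isFourierTransformOfNonneg_iff {F : EuclideanSpace ℝ (Fin n) → ℝ} (hF : Integrable F)
    (hrad : ∀ x y, ‖x‖ = ‖y‖ → F x = F y) :
    IsFourierTransformOfNonneg F ↔ ∀ w, 0 ≤ (𝓕 (fun x => (F x : ℂ)) w).re := by
  set G : EuclideanSpace ℝ (Fin n) → ℝ := fun w => (𝓕 (fun x => (F x : ℂ)) w).re with hG
  have hGc : Continuous G := Complex.continuous_re.comp (continuous_fourier_of_integrable hF.ofReal)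
  constructor
  · rintro ⟨T, hT, hTF⟩ w
    -- Testing `𝓕⁻ T` on `𝓕 φ` recovers `T φ`, so `T` is integration against `G`.
    have hTφ : ∀ φ : 𝓢(EuclideanSpace ℝ (Fin n), ℂ), T φ = ∫ x, φ x * (G x : ℂ) := fun φ => by
      have h := (hTF (𝓕 φ)).2
      rw [TemperedDistribution.fourierInv_apply, FourierTransform.fourierInv_fourier_eq,
        integral_fourier_schwartz_mul hF hrad] at h
      exact h
    by_contra! hw
    have hs : {x | G x < 0} ∈ nhds w := (isOpen_lt hGc continuous_const).mem_nhds hw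
    -- A bump equal to `1` at `w` and supported where `G < 0` would pair negatively with `T`.
    obtain ⟨u, hu1, hu2, hu3, hu4, hu5⟩ := exists_contDiff_tsupport_subset (n := ⊤) hs
    have hunn : ∀ x, 0 ≤ u x := fun x => (hu4 ⟨x, rfl⟩).1
    have hc : HasCompactSupport (Complex.ofRealCLM ∘ u) := hu2.comp_left rfl
    have h0 := hT (hc.toSchwartzMap (Complex.ofRealCLM.contDiff.comp hu3)) hc
      (fun x => by simpa using hunn x)
    rw [hTφ] at h0
    have h1 : ∫ x, (hc.toSchwartzMap (Complex.ofRealCLM.contDiff.comp hu3)) x * (G x : ℂ) =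
        ((∫ x, u x * G x : ℝ) : ℂ) := by
      rw [← integral_complex_ofReal]
      refine integral_congr_ae (Eventually.of_forall fun x => ?_)
      simp
    rw [h1, Complex.zero_le_real] at h0
    have h2 : 0 < ∫ x, u x * -G x := by
      refine Continuous.integral_pos_of_hasCompactSupport_nonneg_nonzero (x := w)
        (hu3.continuous.mul hGc.neg) hu2.mul_right (fun x => ?_) ?_
      · by_cases hx : x ∈ tsupport u
        · have : G x < 0 := hu1 hx
          exact mul_nonneg (hunn x) (by linarith)
        · simp [image_eq_zero_of_notMem_tsupport hx]
      · rw [hu5, one_mul]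
        exact (neg_pos.2 hw).ne'
    simp only [mul_neg, integral_neg] at h2
    linarith
  · intro hnn
    have hm : MemLp (fun x => (F x : ℂ)) 1 volume := memLp_one_iff_integrable.2 hF.ofReal
    have hS : ∀ φ : 𝓢(EuclideanSpace ℝ (Fin n), ℂ),
        Lp.toTemperedDistribution (hm.toLp _) φ = ∫ x, φ x * (F x : ℂ) := fun φ => by
      rw [Lp.toTemperedDistribution_apply]
      refine integral_congr_ae ?_
      filter_upwards [hm.coeFn_toLp] with x hx
      rw [hx, smul_eq_mul]
    refine ⟨𝓕 (Lp.toTemperedDistribution (hm.toLp _)), fun φ _ hφ => ?_, fun φ => ?_⟩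
    · rw [TemperedDistribution.fourier_apply, hS, integral_fourier_schwartz_mul hF hrad]
      exact integral_nonneg fun x => mul_nonneg (hφ x) (Complex.zero_le_real.2 (hnn x))
    · refine ⟨integrable_schwartz_mul hF.ofReal φ, ?_⟩
      rw [FourierTransform.fourierInv_fourier_eq, hS]

end Distribution

/-! ### Continuity and decay in terms of the radial variable -/

theorem continuous_iff_continuous_comp_norm_sq {n : ℕ} (hn : 0 < n) (f : ℝ≥0 → ℝ) :
    Continuous f ↔ Continuous fun x : EuclideanSpace ℝ (Fin n) => f (‖x‖₊ ^ 2) := by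
  refine ⟨fun h => by fun_prop, fun h => ?_⟩
  let e : EuclideanSpace ℝ (Fin n) := EuclideanSpace.single ⟨0, hn⟩ 1
  have he : ‖e‖₊ = 1 := by simp [e]
  have h1 : Continuous fun t : ℝ≥0 => f (‖((NNReal.sqrt t : ℝ≥0) : ℝ) • e‖₊ ^ 2) :=
    h.comp (f := fun t : ℝ≥0 => ((NNReal.sqrt t : ℝ≥0) : ℝ) • e) (by fun_prop)
  simpa only [nnnorm_smul, he, mul_one, NNReal.nnnorm_eq, NNReal.sq_sqrt] using h1

theorem decay_iff_decay_comp_norm_sq {n : ℕ} (hn : 0 < n) (f : ℝ≥0 → ℝ) :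
    (∃ ε > (0 : ℝ), ∃ C > (0 : ℝ), ∀ x : ℝ≥0,
      |f x| ≤ C * (1 + (x : ℝ)) ^ (-((n : ℝ) / 2 - 1) - 1 - ε)) ↔
    ∃ C > (0 : ℝ), ∃ ε > (0 : ℝ), ∀ x : EuclideanSpace ℝ (Fin n),
      |f (‖x‖₊ ^ 2)| ≤ C * (1 + ‖x‖) ^ (-(n : ℝ) - ε) := by
  constructor
  · rintro ⟨ε, hε, C, hC, h⟩
    -- The constant comes from `(1 + r)² ≤ 2 (1 + r²)`, raised to the power `-(n / 2 + ε)`; squaring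
    -- doubles `ε`.
    refine ⟨C * 2 ^ ((n : ℝ) / 2 + ε), by positivity, 2 * ε, by positivity, fun x => ?_⟩
    refine (h _).trans ?_
    rw [mul_assoc]
    gcongr
    have hx := norm_nonneg x
    have e1 : -((n : ℝ) / 2 - 1) - 1 - ε = -((n : ℝ) / 2 + ε) := by ring
    have e2 : (1 + ‖x‖) ^ (-(n : ℝ) - 2 * ε) = ((1 + ‖x‖) ^ 2) ^ (-((n : ℝ) / 2 + ε)) := by
      rw [← Real.rpow_two, ← Real.rpow_mul (by positivity)]
      congr 1; ring
    have e3 : (2 : ℝ) ^ ((n : ℝ) / 2 + ε) = (1 / 2) ^ (-((n : ℝ) / 2 + ε)) := by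
      rw [one_div, Real.inv_rpow two_pos.le, Real.rpow_neg two_pos.le, inv_inv]
    rw [e1, e2, e3, ← Real.mul_rpow (by positivity) (by positivity)]
    refine Real.rpow_le_rpow_of_nonpos (by positivity) ?_
      (neg_nonpos.2 (by positivity))
    push_cast
    nlinarith [sq_nonneg (‖x‖ - 1)]
  · rintro ⟨C, hC, ε, hε, h⟩
    refine ⟨ε / 2, by positivity, C, hC, fun t => ?_⟩
    let e : EuclideanSpace ℝ (Fin n) := EuclideanSpace.single ⟨0, hn⟩ 1
    have he : ‖e‖₊ = 1 := by simp [e]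
    have h1 := h (((NNReal.sqrt t : ℝ≥0) : ℝ) • e)
    have h2 : ‖((NNReal.sqrt t : ℝ≥0) : ℝ) • e‖₊ = NNReal.sqrt t := by
      rw [nnnorm_smul, he, mul_one, NNReal.nnnorm_eq]
    rw [← coe_nnnorm, h2, NNReal.sq_sqrt] at h1
    refine h1.trans ?_
    gcongr
    have e2 : (1 + (NNReal.sqrt t : ℝ)) ^ (-(n : ℝ) - ε) =
        ((1 + (NNReal.sqrt t : ℝ)) ^ 2) ^ (-((n : ℝ) / 2 - 1) - 1 - ε / 2) := by
      rw [← Real.rpow_two, ← Real.rpow_mul (by positivity)]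
      congr 1; ring
    rw [e2]
    -- Here `1 + t ≤ (1 + √t)²` suffices, with no loss in the constant.
    refine Real.rpow_le_rpow_of_nonpos (by positivity) ?_ ?_
    · have h3 : (NNReal.sqrt t : ℝ) ^ 2 = t := by exact_mod_cast NNReal.sq_sqrt t
      nlinarith [NNReal.coe_nonneg (NNReal.sqrt t)]
    · have : (0 : ℝ) ≤ n := Nat.cast_nonneg n
      linarith

theorem integrable_of_decay {n : ℕ} {F : EuclideanSpace ℝ (Fin n) → ℝ} (hF : Continuous F)
    (h : ∃ C > (0 : ℝ), ∃ ε > (0 : ℝ), ∀ x, |F x| ≤ C * (1 + ‖x‖) ^ (-(n : ℝ) - ε)) :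
    MeasureTheory.Integrable F := by
  obtain ⟨C, _, ε, hε, h⟩ := h
  refine ((integrable_one_add_norm (r := n + ε) (by simpa using hε)).const_mul C).mono'
    hF.aestronglyMeasurable (Filter.Eventually.of_forall fun x => ?_)
  rw [neg_add']
  exact h x

theorem corollary2p10 (n : ℕ) (hn : 1 < n) (f : ℝ≥0 → ℝ) :
    IsSILP ((n : ℝ) / 2 - 1) f ↔
      Continuous (fun x : EuclideanSpace ℝ (Fin n) => f (‖x‖₊ ^ 2)) ∧
      (∃ C > (0 : ℝ), ∃ ε > (0 : ℝ), ∀ x : EuclideanSpace ℝ (Fin n),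
        |f (‖x‖₊ ^ 2)| ≤ C * (1 + ‖x‖) ^ (-(n : ℝ) - ε)) ∧
      IsFourierTransformOfNonneg (fun x : EuclideanSpace ℝ (Fin n) => f (‖x‖₊ ^ 2)) := by
  have hn0 : 0 < n := by omega
  have hrad : ∀ x z : EuclideanSpace ℝ (Fin n), ‖x‖ = ‖z‖ → f (‖x‖₊ ^ 2) = f (‖z‖₊ ^ 2) := by
    intro x z h
    rw [show ‖x‖₊ = ‖z‖₊ from NNReal.eq h]
  constructor
  · rintro ⟨hc, hd, hpos⟩
    rw [continuous_iff_continuous_comp_norm_sq hn0] at hc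
    rw [decay_iff_decay_comp_norm_sq hn0] at hd
    have hF := integrable_of_decay hc hd
    refine ⟨hc, hd, (isFourierTransformOfNonneg_iff hF hrad).2 ?_⟩
    refine nonneg_of_gaussian_moments_nonneg n hn0
      (Complex.continuous_re.comp (continuous_fourier_of_integrable hF.ofReal))
      (fun w => (Complex.abs_re_le_norm _).trans (norm_fourier_le _ w))
      (fun v w h => congrArg Complex.re
        (fourier_eq_of_norm_eq (fun x z h => congrArg _ (hrad x z h)) h))
      fun b hb j => ?_
    -- The scale `y = π² / b` realizes the Gaussian parameter `b`; all `b > 0` arise as `y` varies.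
    have hy : 0 < Real.pi ^ 2 / b := by positivity
    have h := (laguerreCoeff_nonneg_iff n hn0 f hF (Real.toNNReal_pos.2 hy) j).1
      (hpos _ (Real.toNNReal_pos.2 hy) j)
    have e : Real.pi ^ 2 / (Real.pi ^ 2 / b) = b := by
      have := Real.pi_pos.ne'
      field_simp
    simpa only [Real.coe_toNNReal _ hy.le, e] using h
  · rintro ⟨hc, hd, hT⟩
    have hF := integrable_of_decay hc hd
    rw [isFourierTransformOfNonneg_iff hF hrad] at hT
    refine ⟨(continuous_iff_continuous_comp_norm_sq hn0 f).2 hc,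
      (decay_iff_decay_comp_norm_sq hn0 f).2 hd, fun y hy j => ?_⟩
    rw [laguerreCoeff_nonneg_iff n hn0 f hF hy j]
    exact MeasureTheory.integral_nonneg fun w => mul_nonneg (hT w) (by positivity)
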